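/- Let $d\ge 1$, let $\mathcal A$ be a finite alphabet with the discrete topology, and let $X\subseteq\mathcal A^{\mathbb Z^d}$ be a subshift of finite type, i.e. the set of all $x\in\mathcal A^{\mathbb Z^d}$ in which no pattern of some finite collection of patterns $\omega\in\mathcal A^{\Lambda}$ ($\Lambda\subseteq\mathbb Z^d$ finite) appears. Let $\sigma^j(x)=(x_{i+j})_{i\in\mathbb Z^d}$, let $\Lambda_n=\{i\in\mathbb Z^d:\max_l|i_l|<n\}$, and let $\mathcal B$ be the Borel $\sigma$-algebra of $X$. Let $f:X\to\mathbb R$ be a function with $d$-summable variation ($f\in SV_d(X)$), that is, $$\sum_{n=1}^{\infty} n^{d-1}\,\delta_n(f)<\infty,\qquad \delta_n(f)=\sup\{|f(x)-f(y)|: x,y\in X,\ x_{\Lambda_n}=y_{\Lambda_n}\}.$$ *Gibbs measures.* Let $\mathfrak T=\{(x,y)\in X\times X: x_{\Lambda^c}=y_{\Lambda^c}\text{ for some finite }\Lambda\subseteq\mathbb Z^d\}$ with the $\sigma$-algebra induced from $X\times X$, let $r(x,y)=x$, $s(x,y)=y$, and let $c_f:\mathfrak T\to\mathbb R$, $c_f(x,y)=\sum_{k\in\mathbb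 Z^d}\big(f(\sigma^k y)-f(\sigma^k x)\big)$ (unordered sum). For a Borel probability measure $\mu$ on $X$ let $\nu_r(C)=\int_X|r^{-1}(\{x\})\cap C|\,d\mu(x)$, and let $\nu_s$ be the image of $\nu_r$ under $(x,y)\mapsto(y,x)$, so that $\nu_s(C)=\int_X|s^{-1}(\{x\})\cap C|\,d\mu(x)$, for measurable $C\subseteq\mathfrak T$. A *Gibbs measure* for $f$ is a Borel probability measure $\mu$ on $X$ that is quasi-invariant under $\mathfrak T$ (if $A\in\mathcal B$ and $\mu(A)=0$, then the union of all $\mathfrak T$-classes meeting $A$ is $\mu$-null) and satisfies $$\frac{d\nu_r}{d\nu_s}=e^{-c_f}\quad\text{almost everywhere on }\mathfrak T.$$ *Specification.* For a nonempty finite $\Lambda\subseteq\mathbb Z^d$, $A\in\mathcal B$ and $x\in X$ let $$\gamma_\Lambda(A|x)=\lim_{n\to\infty}\frac{\sum_{\omega\in\mathcal A^\Lambda}e^{f_n(\omega x_{\Lambda^c})}\mathbf 1_{\{\omega x_{\Lambda^c}\in A\}}}{\sum_{\eta\in\mathcal A^\Lambda}e^{f_n(\eta x_{\Lambda^c})}\mathbf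 1_{\{\eta x_{\Lambda^c}\in X\}}},\qquad f_n=\sum_{i\in\Lambda_n}f\circ\sigma^i,$$ where $\omega x_{\Lambda^c}$ is the configuration equal to $\omega$ on $\Lambda$ and to $x$ on $\Lambda^c$, and terms whose indicator vanishes are $0$. Let $\mathcal B_{\Lambda^c}$ be the $\sigma$-algebra on $X$ generated by the coordinate maps $x\mapsto x_i$, $i\in\Lambda^c$. Then $\mu$ is a Gibbs measure for $f$ if and only if $\mu$ is a Borel probability measure on $X$ that satisfies the DLR equations $$\mu(A|\mathcal B_{\Lambda^c})=\gamma_\Lambda(A|\,\cdot\,)\qquad\mu\text{-a.e.}$$ for every nonempty finite $\Lambda\subseteq\mathbb Z^d$ and every $A\in\mathcal B$. -/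

import Mathlib

open MeasureTheory Filter Topology ProbabilityTheory
open scoped ENNReal

noncomputable section

/-! ### Countable Borel equivalence relations and conformal measures -/

section Conformal

variable {α : Type*} [MeasurableSpace α]

/-- An equivalence relation `R` on `α`, seen as a subset of `α × α`; it carries the σ-algebra
induced from the product. -/
abbrev RelGraph (R : Setoid α) : Type _ := {p : α × α // R p.1 p.2}

/-- The left projection `r (x, y) = x`. -/
def RelGraph.left {R : Setoid α} (p : RelGraph R) : α := p.1.1

/-- The right projection `s (x, y) = y`. -/
def RelGraph.right {R : Setoid α} (p : RelGraph R) : α := p.1.2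

/-- The flip `θ (x, y) = (y, x)`. -/
def RelGraph.flip {R : Setoid α} (p : RelGraph R) : RelGraph R :=
  ⟨(p.1.2, p.1.1), R.symm p.2⟩

/-- The left counting measure `ν_r (C) = ∫ |r⁻¹{x} ∩ C| dμ(x)`: the mixture over `μ` of the
counting measures on the fibres of `r`. -/
def leftCounting (R : Setoid α) (μ : Measure α) : Measure (RelGraph R) :=
  μ.bind fun x => Measure.count.restrict (RelGraph.left ⁻¹' {x})

/-- The right counting measure `ν_s = θ_* ν_r`. -/
def rightCounting (R : Setoid α) (μ : Measure α) : Measure (RelGraph R) :=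
  (leftCounting R μ).map RelGraph.flip

/-- The saturation `R(A)`, the union of the classes that meet `A`. -/
def relSaturation (R : Setoid α) (A : Set α) : Set α := {y | ∃ x ∈ A, R x y}

/-- `μ` is quasi-invariant under `R`: saturations of null sets are null. -/
def IsQuasiInvariant (R : Setoid α) (μ : Measure α) : Prop :=
  ∀ A : Set α, MeasurableSet A → μ A = 0 → μ (relSaturation R A) = 0

/-- `μ` is a `(c, R)`-conformal probability measure: it is quasi-invariant under `R` and its
Radon-Nikodym derivative `D_{μ,R} = dν_r / dν_s` equals `e^{-c}` almost everywhere. -/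
def IsConformal (R : Setoid α) (c : RelGraph R → ℝ) (μ : Measure α) : Prop :=
  IsProbabilityMeasure μ ∧ IsQuasiInvariant R μ ∧
    (leftCounting R μ).rnDeriv (rightCounting R μ) =ᵐ[rightCounting R μ]
      fun p => ENNReal.ofReal (Real.exp (-c p))

end Conformal

/-! ### Subshifts -/

/-- The lattice `ℤ^d`. -/
abbrev Site (d : ℕ) : Type := Fin d → ℤ

/-- The full shift `𝓐^{ℤ^d}`, with the product topology and the product σ-algebra. -/
abbrev FullShift (d : ℕ) (𝓐 : Type*) : Type _ := Site d → 𝓐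

/-- The box `Λ_n = {i ∈ ℤ^d : ‖i‖ < n}`, where `‖i‖ = max |i_l|`. -/
def box (d n : ℕ) : Finset (Site d) :=
  Fintype.piFinset fun _ => Finset.Ioo (-(n : ℤ)) (n : ℤ)

theorem mem_box {d n : ℕ} (hd : 0 < d) (i : Site d) : i ∈ box d n ↔ ‖i‖ < n := by
  have : Nonempty (Fin d) := ⟨⟨0, hd⟩⟩
  rw [box, Fintype.mem_piFinset]
  have key : ∀ l, (i l ∈ Finset.Ioo (-(n : ℤ)) (n : ℤ) ↔ ‖i l‖ < (n : ℝ)) := by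
    intro l
    rw [Finset.mem_Ioo, ← abs_lt, Int.norm_eq_abs]
    exact_mod_cast Iff.rfl
  simp only [key]
  constructor
  · intro h
    have hn : (0 : ℝ) < n := lt_of_le_of_lt (norm_nonneg _) (h ⟨0, hd⟩)
    exact (pi_norm_lt_iff hn).2 h
  · intro h l
    exact (norm_le_pi_norm i l).trans_lt h

/-- The shift by `j`: `σ^j (x) = (x_{i+j})_i`. -/
def fullShiftMap {d : ℕ} {𝓐 : Type*} (j : Site d) (x : FullShift d 𝓐) : FullShift d 𝓐 :=
  fun i => x (i + j)

/-- A subshift: a closed subset of the full shift that is invariant under all translations. -/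
structure Subshift (d : ℕ) (𝓐 : Type*) [TopologicalSpace 𝓐] where
  carrier : Set (FullShift d 𝓐)
  isClosed_carrier : IsClosed carrier
  shift_mem : ∀ (j : Site d), ∀ x ∈ carrier, fullShiftMap j x ∈ carrier

/-- A pattern: a finite set `Λ ⊆ ℤ^d` together with an element of `𝓐^Λ`. -/
abbrev Pattern (d : ℕ) (𝓐 : Type*) : Type _ := Σ Λ : Finset (Site d), (Λ → 𝓐)

/-- The set `X_𝓕` of all configurations in which no pattern of `𝓕` appears. -/
def avoiding {d : ℕ} {𝓐 : Type*} (𝓕 : Set (Pattern d 𝓐)) : Set (FullShift d 𝓐) :=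
  {x | ∀ (j : Site d) (Λ : Finset (Site d)),
    (⟨Λ, fun i => fullShiftMap j x i⟩ : Pattern d 𝓐) ∉ 𝓕}

/-- The configuration `ω x_{Λᶜ}`, equal to `ω` on `Λ` and to `x` off `Λ`. -/
def glue {d : ℕ} {𝓐 : Type*} {Λ : Finset (Site d)} (ω : Λ → 𝓐) (x : FullShift d 𝓐) :
    FullShift d 𝓐 :=
  fun i => if h : i ∈ Λ then ω ⟨i, h⟩ else x i

namespace Subshift

variable {d : ℕ} {𝓐 : Type*} [TopologicalSpace 𝓐]

/-- The points of a subshift. -/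
abbrev Point (X : Subshift d 𝓐) : Type _ := {x : FullShift d 𝓐 // x ∈ X.carrier}

/-- `X` is a subshift of finite type: `X = X_𝓕` for a finite collection `𝓕` of patterns. -/
def IsOfFiniteType (X : Subshift d 𝓐) : Prop :=
  ∃ 𝓕 : Set (Pattern d 𝓐), 𝓕.Finite ∧ X.carrier = avoiding 𝓕

/-- The shift `σ^j` on `X`. -/
def shift (X : Subshift d 𝓐) (j : Site d) (x : X.Point) : X.Point :=
  ⟨fullShiftMap j x.1, X.shift_mem j x.1 x.2⟩

/-- The Gibbs (homoclinic) relation: two points are equivalent if they agree off a finite set. -/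
def gibbsRel (X : Subshift d 𝓐) : Setoid X.Point where
  r x y := ∃ Λ : Finset (Site d), ∀ i ∉ Λ, x.1 i = y.1 i
  iseqv :=
    { refl := fun _ => ⟨∅, fun _ _ => rfl⟩
      symm := fun ⟨Λ, h⟩ => ⟨Λ, fun i hi => (h i hi).symm⟩
      trans := fun ⟨Λ, h⟩ ⟨Δ, k⟩ => ⟨Λ ∪ Δ, fun i hi =>
        (h i fun hΛ => hi (Finset.mem_union_left _ hΛ)).trans
          (k i fun hΔ => hi (Finset.mem_union_right _ hΔ))⟩ }

/-- The `n`-th variation `δ_n (f)`, the supremum of `|f x - f y|` over `x, y ∈ X` that agree on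
`Λ_n`, as a non-negative extended real number. -/
def variation (X : Subshift d 𝓐) (f : X.Point → ℝ) (n : ℕ) : ℝ≥0∞ :=
  ⨆ (x : X.Point) (y : X.Point) (_ : ∀ i ∈ box d n, x.1 i = y.1 i), ENNReal.ofReal |f x - f y|

/-- The set `SV_d (X)` of functions with `d`-summable variation:
`∑_{n ≥ 1} n^{d-1} δ_n (f) < ∞`. -/
def SV (X : Subshift d 𝓐) : Set (X.Point → ℝ) :=
  {f | ∑' n : ℕ, ((n + 1 : ℕ) : ℝ≥0∞) ^ (d - 1) * X.variation f (n + 1) < ⊤}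

/-- The cocycle `c_f (x, y) = ∑_{k ∈ ℤ^d} (f (σ^k y) - f (σ^k x))` on the Gibbs relation, as an
unordered sum. -/
def cocycle (X : Subshift d 𝓐) (f : X.Point → ℝ) (p : RelGraph X.gibbsRel) : ℝ :=
  ∑' k : Site d, (f (X.shift k p.right) - f (X.shift k p.left))

/-- `f_n = ∑_{i ∈ Λ_n} f ∘ σ^i`. -/
def boxSum (X : Subshift d 𝓐) (f : X.Point → ℝ) (n : ℕ) (x : X.Point) : ℝ :=
  ∑ i ∈ box d n, f (X.shift i x)

open Classical in
/-- `∑_{ω ∈ 𝓐^Λ} e^{f_n (ω x_{Λᶜ})} 1_{ω x_{Λᶜ} ∈ A}`. -/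
def boltzmannSum [Fintype 𝓐] (X : Subshift d 𝓐) (f : X.Point → ℝ) (n : ℕ)
    (Λ : Finset (Site d)) (A : Set X.Point) (x : X.Point) : ℝ :=
  ∑ ω : Λ → 𝓐, if h : glue ω x.1 ∈ X.carrier then
    A.indicator (fun z => Real.exp (X.boxSum f n z)) ⟨glue ω x.1, h⟩ else 0

/-- The specification `γ_Λ (A | x)`, the limit as `n → ∞` of
`∑_ω e^{f_n (ω x_{Λᶜ})} 1_{ω x_{Λᶜ} ∈ A} / ∑_η e^{f_n (η x_{Λᶜ})} 1_{η x_{Λᶜ} ∈ X}`. -/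
def specification [Fintype 𝓐] (X : Subshift d 𝓐) (f : X.Point → ℝ) (Λ : Finset (Site d))
    (A : Set X.Point) (x : X.Point) : ℝ :=
  limUnder atTop fun n : ℕ => X.boltzmannSum f n Λ A x / X.boltzmannSum f n Λ Set.univ x

/-- The σ-algebra `𝓑_Δ` on `X` generated by the coordinates in `Δ`. -/
abbrev coordSigma (X : Subshift d 𝓐) (Δ : Set (Site d)) : MeasurableSpace X.Point :=
  MeasurableSpace.generateFrom {S | ∃ i ∈ Δ, ∃ B : Set 𝓐, S = {x : X.Point | x.1 i ∈ B}}

variable [MeasurableSpace 𝓐]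

/-- `μ` is a Gibbs measure for `f`: it is `(c_f, 𝔗)`-conformal for the Gibbs relation `𝔗`. -/
def IsGibbsMeasure (X : Subshift d 𝓐) (f : X.Point → ℝ) (μ : Measure X.Point) : Prop :=
  IsConformal X.gibbsRel (X.cocycle f) μ

/-- `μ` satisfies the DLR equations `μ (A | 𝓑_{Λᶜ}) = γ_Λ (A | ·)` `μ`-a.e., for all non-empty
finite `Λ` and all Borel sets `A`. -/
def SatisfiesDLR [Fintype 𝓐] (X : Subshift d 𝓐) (f : X.Point → ℝ) (μ : Measure X.Point) : Prop :=
  ∀ Λ : Finset (Site d), Λ.Nonempty → ∀ A : Set X.Point, MeasurableSet A →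
    μ⟦A | X.coordSigma (Λ : Set (Site d))ᶜ⟧ =ᵐ[μ] X.specification f Λ A

/-! Consistency facts: the σ-algebra on a subshift is the Borel one, `𝓑_Δ` is contained in it, and
the left counting measure of the Gibbs relation is given by the integral formula. -/

theorem borelSpace_point [Fintype 𝓐] [DiscreteTopology 𝓐] [DiscreteMeasurableSpace 𝓐]
    (X : Subshift d 𝓐) : BorelSpace X.Point := inferInstance

theorem coordSigma_le [DiscreteMeasurableSpace 𝓐] (X : Subshift d 𝓐) (Δ : Set (Site d)) :
    X.coordSigma Δ ≤ (inferInstance : MeasurableSpace X.Point) := by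
  refine MeasurableSpace.generateFrom_le ?_
  rintro _ ⟨i, -, B, rfl⟩
  exact ((measurable_pi_apply i).comp measurable_subtype_coe) (MeasurableSet.of_discrete (s := B))


theorem measurable_glue {Λ : Finset (Site d)} (ω : Λ → 𝓐) :
    Measurable (glue ω : FullShift d 𝓐 → FullShift d 𝓐) := by
  refine measurable_pi_lambda _ fun i => ?_
  by_cases h : i ∈ Λ
  · simpa [glue, h] using measurable_const
  · simpa [glue, h] using measurable_pi_apply i

theorem measurable_fibre_count [Fintype 𝓐] [DiscreteTopology 𝓐] [DiscreteMeasurableSpace 𝓐]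
    (X : Subshift d 𝓐) :
    Measurable fun x : X.Point =>
      (Measure.count.restrict (RelGraph.left ⁻¹' {x}) : Measure (RelGraph X.gibbsRel)) := by
  classical
  have hleft : Measurable (RelGraph.left : RelGraph X.gibbsRel → X.Point) :=
    measurable_fst.comp measurable_subtype_coe
  have hright : Measurable (RelGraph.right : RelGraph X.gibbsRel → X.Point) :=
    measurable_snd.comp measurable_subtype_coe
  refine Measure.measurable_of_measurable_coe _ fun C hC => ?_
  let G : ℕ → Set (RelGraph X.gibbsRel) :=
    fun n => {p | ∀ i ∉ box d n, p.left.1 i = p.right.1 i}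
  have hGmono : Monotone G := by
    intro m n hmn p hp i hi
    refine hp i fun him => hi ?_
    simp only [box, Fintype.mem_piFinset, Finset.mem_Ioo] at him ⊢
    intro l
    have := him l
    omega
  have hGall : ⋃ n, G n = Set.univ := by
    refine Set.eq_univ_of_forall fun p => Set.mem_iUnion.2 ?_
    obtain ⟨Λ, hΛ⟩ := p.2
    refine ⟨(Λ.sup fun i => Finset.univ.sup fun l => (i l).natAbs) + 1, fun i hi => hΛ i fun h => hi ?_⟩
    simp only [box, Fintype.mem_piFinset, Finset.mem_Ioo]
    intro l
    have h1 : (i l).natAbs ≤ Finset.univ.sup fun l => (i l).natAbs :=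
      Finset.le_sup (f := fun l => (i l).natAbs) (Finset.mem_univ l)
    have h2 : (Finset.univ.sup fun l => (i l).natAbs) ≤
        Λ.sup fun i => Finset.univ.sup fun l => (i l).natAbs :=
      Finset.le_sup (f := fun i : Site d => Finset.univ.sup fun l => (i l).natAbs) h
    omega
  have hS : ∀ n (ω : box d n → 𝓐), MeasurableSet {x : X.Point | ∃ p ∈ C, p.left = x ∧
      p.right.1 = glue ω x.1} := by
    intro n ω
    obtain ⟨C', hC', rfl⟩ := hC
    have hT : MeasurableSet {x : X.Point | glue ω x.1 ∈ X.carrier} :=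
      ((measurable_glue ω).comp measurable_subtype_coe) X.isClosed_carrier.measurableSet
    have hm : Measurable fun x : {x : X.Point | glue ω x.1 ∈ X.carrier} =>
        ((x.1, ⟨glue ω x.1.1, x.2⟩) : X.Point × X.Point) :=
      measurable_subtype_coe.prodMk
        (((measurable_glue ω).comp (measurable_subtype_coe.comp measurable_subtype_coe)).subtype_mk)
    convert hT.subtype_image (hm hC') using 1
    ext x
    constructor
    · rintro ⟨p, hp, rfl, hr⟩
      have hmem : glue ω p.left.1 ∈ X.carrier := hr ▸ p.right.2
      refine ⟨⟨p.left, hmem⟩, ?_, rfl⟩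
      have : (⟨glue ω p.left.1, hmem⟩ : X.Point) = p.right := Subtype.ext hr.symm
      simp only [Set.mem_preimage, this]
      exact hp
    · rintro ⟨⟨y, hy⟩, hyC, rfl⟩
      refine ⟨⟨(y, ⟨glue ω y.1, hy⟩), ⟨box d n, fun i hi => ?_⟩⟩, hyC, rfl, rfl⟩
      simp [glue, hi]
  have hcount : ∀ x : X.Point, ∀ n,
      Measure.count (C ∩ RelGraph.left ⁻¹' {x} ∩ G n) =
        ∑ ω : box d n → 𝓐, Set.indicator {x : X.Point | ∃ p ∈ C, p.left = x ∧
          p.right.1 = glue ω x.1} (1 : X.Point → ℝ≥0∞) x := by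
    intro x n
    have hinj : Set.InjOn (fun (p : RelGraph X.gibbsRel) (i : box d n) => p.right.1 i)
        (C ∩ RelGraph.left ⁻¹' {x} ∩ G n) := by
      rintro p ⟨⟨-, hp⟩, hpn⟩ q ⟨⟨-, hq⟩, hqn⟩ hpq
      have hp' : p.left = x := hp
      have hq' : q.left = x := hq
      refine Subtype.ext (Prod.ext (hp'.trans hq'.symm) (Subtype.ext (funext fun i => ?_)))
      by_cases hi : i ∈ box d n
      · exact congrFun hpq ⟨i, hi⟩
      · have h1 := hpn i hi
        have h2 := hqn i hi
        rw [hp'] at h1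
        rw [hq'] at h2
        exact h1.symm.trans h2
    have himg : (fun (p : RelGraph X.gibbsRel) (i : box d n) => p.right.1 i) ''
        (C ∩ RelGraph.left ⁻¹' {x} ∩ G n) =
        ((Finset.univ.filter fun ω : box d n → 𝓐 => ∃ p ∈ C, p.left = x ∧
          p.right.1 = glue ω x.1 : Finset (box d n → 𝓐)) : Set (box d n → 𝓐)) := by
      ext ω
      simp only [Finset.coe_filter, Finset.mem_univ, true_and, Set.mem_setOf_eq]
      constructor
      · rintro ⟨p, ⟨⟨hpC, hp⟩, hpn⟩, rfl⟩
        have hp' : p.left = x := hp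
        refine ⟨p, hpC, hp', funext fun i => ?_⟩
        by_cases hi : i ∈ box d n
        · simp [glue, hi]
        · simp only [glue, hi, dite_false]
          rw [← hp', hpn i hi]
      · rintro ⟨p, hpC, hp, hr⟩
        refine ⟨p, ⟨⟨hpC, hp⟩, fun i hi => ?_⟩, funext fun i => ?_⟩
        · rw [hr, hp]; simp [glue, hi]
        · simp [hr, glue]
    have hmeas : MeasurableSet (C ∩ RelGraph.left ⁻¹' {x} ∩ G n) := by
      refine (hC.inter (hleft (measurableSet_singleton x))).inter ?_
      have : G n = ⋂ i : {i // i ∉ box d n}, {p : RelGraph X.gibbsRel |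
          p.left.1 i = p.right.1 i} := by
        ext p; simp [G]
      rw [this]
      refine MeasurableSet.iInter fun i => measurableSet_eq_fun ?_ ?_
      · exact (measurable_pi_apply i.1).comp (measurable_subtype_coe.comp hleft)
      · exact (measurable_pi_apply i.1).comp (measurable_subtype_coe.comp hright)
    rw [Measure.count_apply hmeas, ← hinj.encard_image, himg, Set.encard_coe_eq_coe_finsetCard,
      Finset.card_filter]
    simp [Set.indicator_apply]
  have hsup : (fun x : X.Point => (Measure.count.restrict (RelGraph.left ⁻¹' {x}) :
      Measure (RelGraph X.gibbsRel)) C) = fun x => ⨆ n, ∑ ω : box d n → 𝓐,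
        Set.indicator {x : X.Point | ∃ p ∈ C, p.left = x ∧ p.right.1 = glue ω x.1}
          (1 : X.Point → ℝ≥0∞) x := by
    funext x
    simp only [← hcount]
    rw [Measure.restrict_apply hC, ← Monotone.measure_iUnion, ← Set.inter_iUnion, hGall,
      Set.inter_univ]
    exact fun m n h => Set.inter_subset_inter_right _ (hGmono h)
  rw [hsup]
  exact Measurable.iSup fun n => Finset.measurable_sum _ fun ω _ =>
    measurable_one.indicator (hS n ω)

theorem leftCounting_gibbsRel [Fintype 𝓐] [DiscreteTopology 𝓐] [DiscreteMeasurableSpace 𝓐]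
    (X : Subshift d 𝓐) (μ : Measure X.Point) {C : Set (RelGraph X.gibbsRel)}
    (hC : MeasurableSet C) :
    leftCounting X.gibbsRel μ C =
      ∫⁻ x, ((RelGraph.left ⁻¹' {x} ∩ C).encard : ℝ≥0∞) ∂μ := by
  have hleft : Measurable (RelGraph.left : RelGraph X.gibbsRel → X.Point) :=
    measurable_fst.comp measurable_subtype_coe
  rw [leftCounting, Measure.bind_apply hC X.measurable_fibre_count.aemeasurable]
  refine lintegral_congr fun x => ?_
  rw [Measure.restrict_apply hC, Set.inter_comm,
    Measure.count_apply ((hleft (measurableSet_singleton x)).inter hC)]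

theorem rightCounting_gibbsRel [Fintype 𝓐] [DiscreteTopology 𝓐] [DiscreteMeasurableSpace 𝓐]
    (X : Subshift d 𝓐) (μ : Measure X.Point) {C : Set (RelGraph X.gibbsRel)}
    (hC : MeasurableSet C) :
    rightCounting X.gibbsRel μ C =
      ∫⁻ x, ((RelGraph.right ⁻¹' {x} ∩ C).encard : ℝ≥0∞) ∂μ := by
  have hflip : Measurable (RelGraph.flip : RelGraph X.gibbsRel → RelGraph X.gibbsRel) :=
    ((measurable_snd.comp measurable_subtype_coe).prodMk
      (measurable_fst.comp measurable_subtype_coe)).subtype_mk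
  have hinv : Function.Involutive (RelGraph.flip : RelGraph X.gibbsRel → RelGraph X.gibbsRel) :=
    fun _ => rfl
  rw [rightCounting, Measure.map_apply hflip hC, leftCounting_gibbsRel X μ (hflip hC)]
  refine lintegral_congr fun x => ?_
  rw [← hinv.injective.encard_image]
  congr 2
  rw [hinv.image_eq_preimage_symm]
  rfl

end Subshift

end

noncomputable section

/-! Both conditions are equivalent to the same detailed balance, one finite `Λ` at a time. Write
w(x, y) = e^{c_f(x, y)} for `weight` and ρ_Λ for `gibbsDensity`; sums over y run over the finitely
many points of X that agree with x off `Λ` (`fibreSum`).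

Convergence: sites k of size r number O(r^{d-1}), and if x, y agree off a box of radius m, then σ^k
x, σ^k y agree on a box of radius r - m + 1. So d-summable variation makes c_f an absolutely
convergent series and a cocycle, with f_n(y) - f_n(x) → c_f(x, y). Hence γ_Λ(A|x) = ∑_y 1_A(y)
ρ_Λ(y) (`specification_eq`), where ρ_Λ(x) w(x, y) = ρ_Λ(y).

Gibbs side: the condition says ν_r = w(y, x) ν_s. Tested on pairs that agree off `Λ`, this reads ∫
∑_y g(x, y) dμ(x) = ∫ ∑_y g(y, x) w(x, y) dμ(x), which is `IsBalanced`. Such pairs exhaust the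
relation as `Λ` grows, so nothing is lost (`withDensity_weight_iff_isBalanced`).

DLR side: γ_Λ(A|·) is 𝓑_{Λᶜ}-measurable and sets of 𝓑_{Λᶜ} are unions of fibres, so the DLR equation
for `Λ` says only that μ γ_Λ = μ, which is `IsResamplingInvariant` (`condExp_eq_specification_iff`).

The two meet in `isBalanced_iff_isResamplingInvariant`, a finite double-sum exchange combined with
ρ_Λ(x) w(x, y) = ρ_Λ(y). -/

/-! ### Lattice points of given size -/

/-- The size `max |i_l|` of a lattice point, as a natural number. -/
def siteSize {d : ℕ} (k : Site d) : ℕ := Finset.univ.sup fun l => (k l).natAbs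

theorem natAbs_le_siteSize {d : ℕ} (k : Site d) (l : Fin d) : (k l).natAbs ≤ siteSize k :=
  Finset.le_sup (f := fun l => (k l).natAbs) (Finset.mem_univ l)

theorem exists_natAbs_eq_siteSize {d : ℕ} (hd : 0 < d) (k : Site d) :
    ∃ l, (k l).natAbs = siteSize k := by
  have : Nonempty (Fin d) := ⟨⟨0, hd⟩⟩
  obtain ⟨l, -, hl⟩ := Finset.exists_mem_eq_sup Finset.univ Finset.univ_nonempty
    fun l => (k l).natAbs
  exact ⟨l, hl.symm⟩

theorem mem_box_iff_natAbs {d n : ℕ} (i : Site d) : i ∈ box d n ↔ ∀ l, (i l).natAbs < n := by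
  simp only [box, Fintype.mem_piFinset, Finset.mem_Ioo]
  exact forall_congr' fun l => by omega

theorem box_mono (d : ℕ) : Monotone (box d) := fun m n h i hi => by
  rw [mem_box_iff_natAbs] at hi ⊢
  exact fun l => (hi l).trans_le h

theorem exists_subset_box {d : ℕ} (Λ : Finset (Site d)) : ∃ m, Λ ⊆ box d m := by
  refine ⟨Λ.sup siteSize + 1, fun i hi => (mem_box_iff_natAbs i).2 fun l => ?_⟩
  exact Nat.lt_succ_of_le ((natAbs_le_siteSize i l).trans (Finset.le_sup hi))

theorem tendsto_box_atTop (d : ℕ) : Tendsto (box d) atTop atTop :=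
  tendsto_atTop_finset_of_monotone (box_mono d) fun i => by
    obtain ⟨m, hm⟩ := exists_subset_box {i}
    exact ⟨m, hm (Finset.mem_singleton_self i)⟩

/-- A point of size r lies on one of the 2d faces of a cube: some coordinate is ±r, the others lie
in [-r, r]. The exponent d - 1 is the one in the definition of `SV`. -/
theorem encard_sphere_le {d : ℕ} (hd : 0 < d) (r : ℕ) :
    {k : Site d | siteSize k = r}.encard ≤ (d * (2 * (2 * r + 1) ^ (d - 1)) : ℕ) := by
  classical
  let T : Fin d → Finset (Site d) := fun l =>
    Fintype.piFinset fun j => if j = l then {(r : ℤ), -(r : ℤ)} else Finset.Icc (-(r : ℤ)) r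
  have hT : ∀ l, (T l).card ≤ 2 * (2 * r + 1) ^ (d - 1) := by
    intro l
    rw [Fintype.card_piFinset, ← Finset.mul_prod_erase _ _ (Finset.mem_univ l)]
    refine Nat.mul_le_mul (by simpa using Finset.card_le_two) ?_
    refine (Finset.prod_le_pow_card _ _ (2 * r + 1) fun j hj => ?_).trans ?_
    · rw [if_neg (Finset.ne_of_mem_erase hj), Int.card_Icc]
      omega
    · simp
  have hsub : {k : Site d | siteSize k = r} ⊆ (Finset.univ.biUnion T : Finset (Site d)) := by
    intro k hk
    have hk : siteSize k = r := hk
    obtain ⟨l, hl⟩ := exists_natAbs_eq_siteSize hd k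
    refine Finset.mem_coe.2 (Finset.mem_biUnion.2 ⟨l, Finset.mem_univ l, ?_⟩)
    refine Fintype.mem_piFinset.2 fun j => ?_
    by_cases hj : j = l
    · subst hj
      simp only [if_true, Finset.mem_insert, Finset.mem_singleton]
      omega
    · have := natAbs_le_siteSize k j
      simp only [hj, if_false, Finset.mem_Icc]
      omega
  refine (Set.encard_le_encard hsub).trans ?_
  rw [Set.encard_coe_eq_coe_finsetCard]
  refine Nat.cast_le.2 (Finset.card_biUnion_le.trans ?_)
  refine (Finset.sum_le_sum fun l _ => hT l).trans ?_
  simp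

namespace Subshift

variable {d : ℕ} {𝓐 : Type*} [TopologicalSpace 𝓐]

/-! ### Regularity of functions with summable variation -/

section Regularity

variable {X : Subshift d 𝓐} {f : X.Point → ℝ}

theorem ofReal_abs_sub_le_variation {n : ℕ} {x y : X.Point}
    (h : ∀ i ∈ box d n, x.1 i = y.1 i) : ENNReal.ofReal |f x - f y| ≤ X.variation f n :=
  le_iSup_of_le x (le_iSup_of_le y (le_iSup_of_le h le_rfl))

theorem variation_le_of_SV (n : ℕ) : X.variation f (n + 1) ≤
    ((n + 1 : ℕ) : ℝ≥0∞) ^ (d - 1) * X.variation f (n + 1) :=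
  le_mul_of_one_le_left' (one_le_pow₀ (by exact_mod_cast Nat.le_add_left 1 n))

theorem variation_ne_top (hf : f ∈ X.SV) (n : ℕ) : X.variation f (n + 1) ≠ ⊤ :=
  (((variation_le_of_SV n).trans (ENNReal.le_tsum n)).trans_lt hf).ne

/-- The variations tend to 0, being bounded by the terms of a convergent series, and agreement on a
box is an open condition over a discrete alphabet. -/
theorem continuous_of_SV [DiscreteTopology 𝓐] (hf : f ∈ X.SV) : Continuous f := by
  have h0 : Tendsto (fun n => X.variation f (n + 1)) atTop (𝓝 0) :=
    tendsto_of_tendsto_of_tendsto_of_le_of_le tendsto_const_nhds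
      (ENNReal.tendsto_atTop_zero_of_tsum_ne_top (ne_of_lt hf)) (fun _ => zero_le)
      fun n => variation_le_of_SV n
  refine continuous_iff_continuousAt.2 fun x => Metric.tendsto_nhds.2 fun ε hε => ?_
  obtain ⟨n, hn⟩ := (h0.eventually_lt_const (ENNReal.ofReal_pos.2 hε)).exists
  have hU : ∀ᶠ y : X.Point in 𝓝 x, ∀ i ∈ box d (n + 1), y.1 i = x.1 i := by
    refine (Finset.eventually_all _).2 fun i _ => ?_
    have hc : Continuous fun y : X.Point => y.1 i := (continuous_apply i).comp continuous_subtype_val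
    exact hc.continuousAt.eventually ((isOpen_discrete {x.1 i}).mem_nhds rfl)
  filter_upwards [hU] with y hy
  rw [Real.dist_eq]
  exact (ENNReal.ofReal_lt_ofReal_iff hε).1 ((ofReal_abs_sub_le_variation hy).trans_lt hn)

/-- This is the dominating series for the cocycle. Grouping sites by size r = n + m leaves O((n +
1)^{d-1}) copies of the variation of index n + 1, with a constant depending on d and m. -/
theorem summable_variation_siteSize (hd : 0 < d) (hf : f ∈ X.SV) (m : ℕ) :
    Summable fun k : Site d =>
      if m ≤ siteSize k then (X.variation f (siteSize k - m + 1)).toReal else 0 := by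
  let F : ℕ → ℝ≥0∞ := fun r => if m ≤ r then X.variation f (r - m + 1) else 0
  have hsum : ∑' k : Site d, F (siteSize k) ≠ ⊤ := by
    have hfib : ∀ r, ∑' k : siteSize (d := d) ⁻¹' {r}, F (siteSize k.1) ≤
        ((d * (2 * (2 * r + 1) ^ (d - 1)) : ℕ) : ℝ≥0∞) * F r := by
      intro r
      have : ∀ k : siteSize (d := d) ⁻¹' {r}, F (siteSize k.1) = F r := fun k => by
        rw [show siteSize k.1 = r from k.2]
      simp only [this]
      rw [ENNReal.tsum_const]
      refine mul_le_mul' ?_ le_rfl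
      have := encard_sphere_le hd r
      have h2 : ENat.card (siteSize (d := d) ⁻¹' {r}) ≤ (d * (2 * (2 * r + 1) ^ (d - 1)) : ℕ) := this
      exact_mod_cast (ENat.toENNReal_le.2 h2)
    rw [← ENNReal.tsum_fiberwise _ (siteSize (d := d))]
    refine ((ENNReal.tsum_le_tsum hfib).trans_lt ?_).ne
    -- The guard `m ≤ r` in `F` confines its support to r = n + m, so truncated subtraction never
    -- intervenes.
    have hinj : Function.Injective fun n : ℕ => n + m := add_left_injective m
    rw [← hinj.tsum_eq]
    · have hle : ∀ n : ℕ, ((d * (2 * (2 * (n + m) + 1) ^ (d - 1)) : ℕ) : ℝ≥0∞) * F (n + m) ≤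
          ((d * (2 * (2 * m + 2) ^ (d - 1)) : ℕ) : ℝ≥0∞) *
            (((n + 1 : ℕ) : ℝ≥0∞) ^ (d - 1) * X.variation f (n + 1)) := by
        intro n
        have hF : F (n + m) = X.variation f (n + 1) := by simp [F]
        rw [hF, ← mul_assoc (_ : ℝ≥0∞)]
        refine mul_le_mul' ?_ le_rfl
        have : d * (2 * (2 * (n + m) + 1) ^ (d - 1)) ≤
            d * (2 * (2 * m + 2) ^ (d - 1)) * (n + 1) ^ (d - 1) := by
          rw [mul_assoc, mul_assoc, ← mul_pow]
          gcongr
          nlinarith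
        exact_mod_cast this
      refine (ENNReal.tsum_le_tsum hle).trans_lt ?_
      rw [ENNReal.tsum_mul_left]
      exact ENNReal.mul_lt_top (ENNReal.natCast_lt_top _) hf
    · intro r hr
      by_cases hmr : m ≤ r
      · exact ⟨r - m, Nat.sub_add_cancel hmr⟩
      · simp [F, hmr] at hr
  refine (ENNReal.summable_toReal hsum).congr fun k => ?_
  simp only [F]
  split_ifs <;> simp

theorem summable_cocycle (hd : 0 < d) (hf : f ∈ X.SV) {x y : X.Point}
    (h : X.gibbsRel x y) : Summable fun k : Site d => f (X.shift k y) - f (X.shift k x) := by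
  obtain ⟨Λ, hΛ⟩ := h
  obtain ⟨m, hm⟩ := exists_subset_box Λ
  -- The finitely many sites in the box of radius m escape the bound and do not affect summability.
  refine Summable.of_norm_bounded_eventually (summable_variation_siteSize hd hf m) ?_
  refine Set.Finite.subset (box d m).finite_toSet fun k hk => ?_
  by_contra hkm
  refine hk ?_
  have hmk : m ≤ siteSize k := by
    by_contra hlt
    exact hkm ((mem_box_iff_natAbs k).2 fun l =>
      (natAbs_le_siteSize k l).trans_lt (not_le.1 hlt))
  change ‖f (X.shift k y) - f (X.shift k x)‖ ≤ _
  rw [if_pos hmk, Real.norm_eq_abs]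
  refine (ENNReal.ofReal_le_iff_le_toReal (variation_ne_top hf _)).1
    (ofReal_abs_sub_le_variation fun i hi => ?_)
  refine (hΛ (i + k) fun hik => ?_).symm
  -- In a coordinate where k attains its size, |i_l| ≤ |k| - m and |i_l + k_l| < m would give |k_l|
  -- < |k|.
  obtain ⟨l, hl⟩ := exists_natAbs_eq_siteSize hd k
  have h1 := (mem_box_iff_natAbs _).1 (hm hik) l
  have h2 := (mem_box_iff_natAbs _).1 hi l
  simp only [Pi.add_apply] at h1
  omega

theorem tendsto_boxSum_sub (hd : 0 < d) (hf : f ∈ X.SV) {x y : X.Point}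
    (h : X.gibbsRel x y) : Tendsto (fun n => X.boxSum f n y - X.boxSum f n x) atTop
      (𝓝 (X.cocycle f ⟨(x, y), h⟩)) := by
  have := (summable_cocycle hd hf h).hasSum.comp (tendsto_box_atTop d)
  refine this.congr fun n => ?_
  simp [boxSum, Finset.sum_sub_distrib]

end Regularity

/-! ### The Boltzmann weight -/

section Weight

variable (X : Subshift d 𝓐) (f : X.Point → ℝ)

/-- The relative weight of `y` with respect to `x`; it equals `e^{c_f (x, y)}` on the Gibbs
relation. -/
def weight (x y : X.Point) : ℝ≥0∞ :=
  limsup (fun n => ENNReal.ofReal (Real.exp (X.boxSum f n y - X.boxSum f n x))) atTop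

variable {X f}

theorem weight_eq_of_rel (hd : 0 < d) (hf : f ∈ X.SV) {x y : X.Point} (h : X.gibbsRel x y) :
    X.weight f x y = ENNReal.ofReal (Real.exp (X.cocycle f ⟨(x, y), h⟩)) :=
  (ENNReal.tendsto_ofReal (Real.continuous_exp.continuousAt.tendsto.comp
    (tendsto_boxSum_sub hd hf h))).limsup_eq

theorem weight_self (x : X.Point) : X.weight f x x = 1 := by
  simp [weight]

/-- Differences of box sums telescope, and the identity passes to the limit. -/
theorem cocycle_add (hd : 0 < d) (hf : f ∈ X.SV) {x y z : X.Point} (h : X.gibbsRel x y)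
    (h' : X.gibbsRel y z) : X.cocycle f ⟨(x, y), h⟩ + X.cocycle f ⟨(y, z), h'⟩ =
      X.cocycle f ⟨(x, z), X.gibbsRel.trans h h'⟩ := by
  refine tendsto_nhds_unique ((tendsto_boxSum_sub hd hf h).add (tendsto_boxSum_sub hd hf h'))
    ((tendsto_boxSum_sub hd hf (X.gibbsRel.trans h h')).congr fun n => ?_)
  ring

theorem weight_mul_weight (hd : 0 < d) (hf : f ∈ X.SV) {x y z : X.Point}
    (h : X.gibbsRel x y) (h' : X.gibbsRel y z) :
    X.weight f x y * X.weight f y z = X.weight f x z := by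
  rw [weight_eq_of_rel hd hf h, weight_eq_of_rel hd hf h',
    weight_eq_of_rel hd hf (X.gibbsRel.trans h h'), ← ENNReal.ofReal_mul (Real.exp_nonneg _),
    ← Real.exp_add, cocycle_add hd hf]

theorem weight_ne_top (hd : 0 < d) (hf : f ∈ X.SV) {x y : X.Point} (h : X.gibbsRel x y) :
    X.weight f x y ≠ ⊤ := by
  rw [weight_eq_of_rel hd hf h]
  exact ENNReal.ofReal_ne_top

theorem weight_ne_zero (hd : 0 < d) (hf : f ∈ X.SV) {x y : X.Point} (h : X.gibbsRel x y) :
    X.weight f x y ≠ 0 := by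
  rw [weight_eq_of_rel hd hf h]
  simpa using Real.exp_pos _

/-- The cocycle is antisymmetric, so the sign in the Gibbs density becomes a swap of the arguments
of the weight. -/
theorem ofReal_exp_neg_cocycle (hd : 0 < d) (hf : f ∈ X.SV) (p : RelGraph X.gibbsRel) :
    ENNReal.ofReal (Real.exp (-X.cocycle f p)) = X.weight f p.right p.left := by
  have h := cocycle_add hd hf p.2 (X.gibbsRel.symm p.2)
  have h0 : X.cocycle f ⟨(p.1.1, p.1.1), X.gibbsRel.refl _⟩ = 0 := by
    simp [cocycle, RelGraph.left, RelGraph.right]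
  rw [show p.right = p.1.2 from rfl, show p.left = p.1.1 from rfl,
    weight_eq_of_rel hd hf (X.gibbsRel.symm p.2)]
  congr 2
  rw [h0] at h
  exact (eq_neg_of_add_eq_zero_right h).symm

theorem measurable_shift [MeasurableSpace 𝓐] (j : Site d) : Measurable (X.shift j) :=
  Measurable.subtype_mk (measurable_pi_lambda (fun (x : X.Point) i => x.1 (i + j)) fun i =>
    (measurable_pi_apply (i + j)).comp measurable_subtype_coe)

theorem measurable_of_SV [Fintype 𝓐] [DiscreteTopology 𝓐] [MeasurableSpace 𝓐]
    [DiscreteMeasurableSpace 𝓐] (hf : f ∈ X.SV) : Measurable f :=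
  (continuous_of_SV hf).measurable

/-- Taking a limsup defines the weight on all pairs, related or not, as a countable limit operation
on measurable functions. -/
theorem measurable_weight [MeasurableSpace 𝓐] (hf : Measurable f) :
    Measurable fun p : X.Point × X.Point => X.weight f p.1 p.2 := by
  have hb : ∀ n, Measurable (X.boxSum f n) := fun n =>
    Finset.measurable_sum _ fun i _ => hf.comp (measurable_shift i)
  refine Measurable.limsup fun n => ?_
  exact (((hb n).comp measurable_snd).sub ((hb n).comp measurable_fst)).exp.ennreal_ofReal

end Weight

/-! ### Sums over the configurations that agree off a finite set -/

section FibreSum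

/-- The points `x` and `y` agree off `Λ`. -/
def AgreeOff (X : Subshift d 𝓐) (Λ : Finset (Site d)) (x y : X.Point) : Prop :=
  ∀ i ∉ Λ, x.1 i = y.1 i

variable {X : Subshift d 𝓐} {Λ : Finset (Site d)}

theorem AgreeOff.rel {x y : X.Point} (h : X.AgreeOff Λ x y) : X.gibbsRel x y := ⟨Λ, h⟩

theorem AgreeOff.symm {x y : X.Point} (h : X.AgreeOff Λ x y) : X.AgreeOff Λ y x :=
  fun i hi => (h i hi).symm

theorem agreeOff_glue (x : X.Point) (ω : Λ → 𝓐) (hω : glue ω x.1 ∈ X.carrier) :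
    X.AgreeOff Λ x ⟨glue ω x.1, hω⟩ := fun i hi => by simp [glue, hi]

theorem AgreeOff.glue_restrict {x y : X.Point} (h : X.AgreeOff Λ x y) :
    glue (fun i : Λ => y.1 i) x.1 = y.1 := by
  funext i
  by_cases hi : i ∈ Λ
  · simp [glue, hi]
  · simp [glue, hi, h i hi]

theorem AgreeOff.glue_eq {x y : X.Point} (h : X.AgreeOff Λ x y) (ω : Λ → 𝓐) :
    glue ω x.1 = glue ω y.1 := by
  funext i
  by_cases hi : i ∈ Λ
  · simp [glue, hi]
  · simp [glue, hi, h i hi]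

/-- The sets that do not separate points agreeing off `Λ` form a σ-algebra containing the
generators. This makes the specification proper. -/
theorem AgreeOff.mem_iff_of_measurableSet {s : Set X.Point}
    (hs : MeasurableSet[X.coordSigma (Λ : Set (Site d))ᶜ] s) {x y : X.Point}
    (h : X.AgreeOff Λ x y) : x ∈ s ↔ y ∈ s := by
  induction s, hs using MeasurableSpace.generateFrom_induction with
  | hC t ht _ =>
    obtain ⟨i, hi, B, rfl⟩ := ht
    change x.1 i ∈ B ↔ y.1 i ∈ B
    rw [h i (by simpa using hi)]
  | empty => simp
  | compl t _ ih => exact not_congr ih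
  | iUnion t _ ih => simp [ih]

variable [Fintype 𝓐]

open Classical in
/-- The sum of `h` over the points of `X` that agree with `x` off `Λ`. -/
def fibreSum (X : Subshift d 𝓐) (Λ : Finset (Site d)) (h : X.Point → ℝ≥0∞) (x : X.Point) : ℝ≥0∞ :=
  ∑ ω : Λ → 𝓐, if hω : glue ω x.1 ∈ X.carrier then h ⟨glue ω x.1, hω⟩ else 0

theorem fibreSum_congr {h h' : X.Point → ℝ≥0∞} {x : X.Point}
    (hh : ∀ y, X.AgreeOff Λ x y → h y = h' y) : X.fibreSum Λ h x = X.fibreSum Λ h' x := by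
  refine Finset.sum_congr rfl fun ω _ => ?_
  split_ifs with hω
  · exact hh _ (agreeOff_glue x ω hω)
  · rfl

theorem AgreeOff.fibreSum_eq {x y : X.Point} (hxy : X.AgreeOff Λ x y) (h : X.Point → ℝ≥0∞) :
    X.fibreSum Λ h x = X.fibreSum Λ h y := by
  refine Finset.sum_congr rfl fun ω _ => ?_
  have hg := hxy.glue_eq ω
  by_cases hω : glue ω y.1 ∈ X.carrier
  · rw [dif_pos hω, dif_pos (hg ▸ hω)]
    exact congrArg h (Subtype.ext hg)
  · rw [dif_neg hω, dif_neg (hg ▸ hω)]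

theorem fibreSum_add (h h' : X.Point → ℝ≥0∞) (x : X.Point) :
    X.fibreSum Λ (fun y => h y + h' y) x = X.fibreSum Λ h x + X.fibreSum Λ h' x := by
  simp only [fibreSum, ← Finset.sum_add_distrib]
  refine Finset.sum_congr rfl fun ω _ => ?_
  split_ifs <;> simp

theorem fibreSum_const_mul (c : ℝ≥0∞) (h : X.Point → ℝ≥0∞) (x : X.Point) :
    X.fibreSum Λ (fun y => c * h y) x = c * X.fibreSum Λ h x := by
  simp only [fibreSum, Finset.mul_sum]
  refine Finset.sum_congr rfl fun ω _ => ?_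
  split_ifs <;> simp

theorem fibreSum_iSup {h : ℕ → X.Point → ℝ≥0∞} (hh : Monotone h) (x : X.Point) :
    X.fibreSum Λ (fun y => ⨆ n, h n y) x = ⨆ n, X.fibreSum Λ (h n) x := by
  simp only [fibreSum]
  rw [← ENNReal.finsetSum_iSup_of_monotone]
  · refine Finset.sum_congr rfl fun ω _ => ?_
    split_ifs <;> simp
  · intro ω m n hmn
    dsimp only
    split_ifs
    · exact hh hmn _
    · exact le_rfl

theorem fibreSum_mono {h h' : X.Point → ℝ≥0∞} (hh : h ≤ h') (x : X.Point) :
    X.fibreSum Λ h x ≤ X.fibreSum Λ h' x := by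
  refine Finset.sum_le_sum fun ω _ => ?_
  split_ifs
  · exact hh _
  · exact le_rfl

/-- Points of one fibre have that same fibre, so both sides are sums over all ordered pairs from the
fibre of x. -/
theorem fibreSum_comm (g : X.Point → X.Point → ℝ≥0∞) (x : X.Point) :
    X.fibreSum Λ (fun y => X.fibreSum Λ (g y) y) x =
      X.fibreSum Λ (fun z => X.fibreSum Λ (fun y => g y z) z) x := by
  have key : ∀ k : X.Point → X.Point → ℝ≥0∞, X.fibreSum Λ (fun y => X.fibreSum Λ (k y) y) x =
      X.fibreSum Λ (fun y => X.fibreSum Λ (k y) x) x := fun k =>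
    fibreSum_congr fun y hy => hy.symm.fibreSum_eq _
  rw [key, key fun z y => g y z]
  classical
  have hswap : ∀ k : X.Point → X.Point → ℝ≥0∞, X.fibreSum Λ (fun y => X.fibreSum Λ (k y) x) x =
      ∑ ω : Λ → 𝓐, ∑ η : Λ → 𝓐, if h : glue ω x.1 ∈ X.carrier ∧ glue η x.1 ∈ X.carrier then
        k ⟨glue ω x.1, h.1⟩ ⟨glue η x.1, h.2⟩ else 0 := by
    intro k
    simp only [fibreSum]
    refine Finset.sum_congr (by congr!) fun ω _ => ?_
    by_cases hω : glue ω x.1 ∈ X.carrier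
    · simp only [hω, true_and, dite_true]
    · simp [hω]
  rw [hswap, hswap, Finset.sum_comm]
  refine Finset.sum_congr rfl fun ω _ => Finset.sum_congr rfl fun η _ => ?_
  by_cases hω : glue ω x.1 ∈ X.carrier <;> by_cases hη : glue η x.1 ∈ X.carrier <;> simp [hω, hη]

theorem le_fibreSum (h : X.Point → ℝ≥0∞) (x : X.Point) : h x ≤ X.fibreSum Λ h x := by
  classical
  have hx : glue (fun i : Λ => x.1 i) x.1 = x.1 := AgreeOff.glue_restrict fun _ _ => rfl
  refine le_trans ?_ (Finset.single_le_sum (fun _ _ => zero_le)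
    (Finset.mem_univ (fun i : Λ => x.1 i)))
  have hmem : glue (fun i : Λ => x.1 i) x.1 ∈ X.carrier := hx.symm ▸ x.2
  rw [dif_pos hmem]
  exact (congrArg h (Subtype.ext hx)).ge

theorem fibreSum_ne_top {h : X.Point → ℝ≥0∞} {x : X.Point}
    (hh : ∀ y, X.AgreeOff Λ x y → h y ≠ ⊤) : X.fibreSum Λ h x ≠ ⊤ := by
  refine ENNReal.sum_ne_top.2 fun ω _ => ?_
  split_ifs with hω
  · exact hh _ (agreeOff_glue x ω hω)
  · exact ENNReal.zero_ne_top

section Measurability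

variable [DiscreteTopology 𝓐] [MeasurableSpace 𝓐] [DiscreteMeasurableSpace 𝓐]

/-- Only the glued configurations need be measurable, not `u`. With β = X this covers the Borel
σ-algebra and also 𝓑_{Λᶜ}, for which the identity into the Borel space is in general not measurable.
-/
theorem measurable_fibreSum_of_measurable_glue {β : Type*} [MeasurableSpace β] {u : β → X.Point}
    (hu : ∀ ω : Λ → 𝓐, Measurable fun b => glue ω (u b).1) {g : β → X.Point → ℝ≥0∞}
    (hg : Measurable fun p : β × X.Point => g p.1 p.2) :
    Measurable fun b => X.fibreSum Λ (g b) (u b) := by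
  classical
  refine Finset.measurable_sum _ fun ω _ => ?_
  have hS : MeasurableSet {b | glue ω (u b).1 ∈ X.carrier} :=
    hu ω X.isClosed_carrier.measurableSet
  refine Measurable.dite (s := {b | glue ω (u b).1 ∈ X.carrier})
    (f := fun b => g b.1 ⟨glue ω (u b.1).1, b.2⟩) ?_ (g := fun _ => 0) measurable_const hS
  exact hg.comp (measurable_subtype_coe.prodMk (((hu ω).comp measurable_subtype_coe).subtype_mk))

theorem measurable_fibreSum {g : X.Point → X.Point → ℝ≥0∞}
    (hg : Measurable fun p : X.Point × X.Point => g p.1 p.2) :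
    Measurable fun x => X.fibreSum Λ (g x) x :=
  measurable_fibreSum_of_measurable_glue (u := id)
    (fun ω => (measurable_glue ω).comp measurable_subtype_coe) hg

theorem measurable_fibreSum_const {h : X.Point → ℝ≥0∞} (hh : Measurable h) :
    Measurable (X.fibreSum Λ h) :=
  measurable_fibreSum (g := fun _ => h) (hh.comp measurable_snd)

theorem measurable_fibreSum_coordSigma {h : X.Point → ℝ≥0∞} (hh : Measurable h) :
    Measurable[X.coordSigma (Λ : Set (Site d))ᶜ] (X.fibreSum Λ h) := by
  refine @measurable_fibreSum_of_measurable_glue d 𝓐 _ X Λ _ _ _ _ X.Point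
    (X.coordSigma (Λ : Set (Site d))ᶜ) id (fun ω => ?_) (fun _ => h) ?_
  -- Each coordinate of the glued configuration is constant or a coordinate of x outside `Λ`.
  · refine @measurable_pi_lambda _ _ _ (X.coordSigma _) _ _ fun i => ?_
    by_cases hi : i ∈ Λ
    · simp [glue, hi, @measurable_const _ _ _ (X.coordSigma _)]
    · simp only [glue, hi, dite_false, id]
      exact fun B _ => MeasurableSpace.measurableSet_generateFrom ⟨i, by simpa using hi, B, rfl⟩
  · exact hh.comp (@measurable_snd _ _ (X.coordSigma _) _)

end Measurability

end FibreSum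

/-! ### The Gibbs density and the specification -/

section Density

variable [Fintype 𝓐] {X : Subshift d 𝓐} {f : X.Point → ℝ} {Λ : Finset (Site d)}

/-- The normalized Boltzmann weight of `x` among the points that agree with `x` off `Λ`. -/
def gibbsDensity (X : Subshift d 𝓐) (f : X.Point → ℝ) (Λ : Finset (Site d)) (x : X.Point) : ℝ≥0∞ :=
  (X.fibreSum Λ (X.weight f x) x)⁻¹

theorem fibreSum_weight_ne_zero (x : X.Point) : X.fibreSum Λ (X.weight f x) x ≠ 0 := fun h => by
  have h1 := le_fibreSum (Λ := Λ) (X.weight f x) x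
  rw [h, weight_self] at h1
  exact one_ne_zero (le_zero_iff.1 h1)

theorem fibreSum_weight_ne_top (hd : 0 < d) (hf : f ∈ X.SV) (x : X.Point) :
    X.fibreSum Λ (X.weight f x) x ≠ ⊤ :=
  fibreSum_ne_top fun _ hy => weight_ne_top hd hf hy.rel

/-- Detailed balance. By the cocycle identity, the normalizing sum based at x is w(x, y) times the
one based at y. -/
theorem gibbsDensity_mul_weight (hd : 0 < d) (hf : f ∈ X.SV) {x y : X.Point}
    (h : X.AgreeOff Λ x y) :
    X.gibbsDensity f Λ x * X.weight f x y = X.gibbsDensity f Λ y := by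
  have hZ : X.fibreSum Λ (X.weight f x) x =
      X.fibreSum Λ (X.weight f y) y * X.weight f x y := by
    rw [mul_comm, ← fibreSum_const_mul, h.fibreSum_eq]
    exact fibreSum_congr fun z hz => (weight_mul_weight hd hf h.rel hz.rel).symm
  have h0 := weight_ne_zero hd hf h.rel
  have h1 := weight_ne_top hd hf h.rel
  rw [gibbsDensity, gibbsDensity, hZ, ENNReal.mul_inv (Or.inr h1) (Or.inr h0), mul_assoc,
    ENNReal.inv_mul_cancel h0 h1, mul_one]

theorem fibreSum_gibbsDensity (hd : 0 < d) (hf : f ∈ X.SV) (x : X.Point) :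
    X.fibreSum Λ (X.gibbsDensity f Λ) x = 1 := by
  rw [fibreSum_congr fun y hy => (gibbsDensity_mul_weight hd hf hy).symm, fibreSum_const_mul,
    gibbsDensity, ENNReal.inv_mul_cancel (fibreSum_weight_ne_zero x)
      (fibreSum_weight_ne_top hd hf x)]

theorem fibreSum_indicator_gibbsDensity (hd : 0 < d) (hf : f ∈ X.SV) (A : Set X.Point)
    (x : X.Point) : X.fibreSum Λ (A.indicator (X.gibbsDensity f Λ)) x =
      X.fibreSum Λ (A.indicator (X.weight f x)) x / X.fibreSum Λ (X.weight f x) x := by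
  rw [div_eq_mul_inv, mul_comm, ← gibbsDensity, ← fibreSum_const_mul]
  refine fibreSum_congr fun y hy => ?_
  by_cases hA : y ∈ A
  · simp [hA, gibbsDensity_mul_weight hd hf hy]
  · simp [hA]

/-- The box sums themselves need not converge. Dividing by e^{f_n(x)} leaves only differences, which
do; the factor cancels in the quotient defining the specification. -/
theorem tendsto_boltzmannSum (hd : 0 < d) (hf : f ∈ X.SV) (A : Set X.Point) (x : X.Point) :
    Tendsto (fun n => X.boltzmannSum f n Λ A x / Real.exp (X.boxSum f n x)) atTop
      (𝓝 (X.fibreSum Λ (A.indicator (X.weight f x)) x).toReal) := by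
  classical
  have hfin : ∀ y, X.AgreeOff Λ x y → A.indicator (X.weight f x) y ≠ ⊤ := fun y hy =>
    ((Set.indicator_le_self A _ y).trans_lt (weight_ne_top hd hf hy.rel).lt_top).ne
  simp only [boltzmannSum, fibreSum]
  rw [ENNReal.toReal_sum]
  · simp only [Finset.sum_div]
    refine tendsto_finsetSum _ fun ω _ => ?_
    by_cases hω : glue ω x.1 ∈ X.carrier
    · simp only [hω, dite_true]
      have hag := agreeOff_glue x ω hω
      by_cases hA : (⟨glue ω x.1, hω⟩ : X.Point) ∈ A
      · simp only [Set.indicator_of_mem hA, ← Real.exp_sub]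
        rw [weight_eq_of_rel hd hf hag.rel, ENNReal.toReal_ofReal (Real.exp_nonneg _)]
        exact Real.continuous_exp.continuousAt.tendsto.comp (tendsto_boxSum_sub hd hf hag.rel)
      · simp [Set.indicator_of_notMem hA]
    · simp [hω]
  · intro ω _
    split_ifs with hω
    · exact hfin _ (agreeOff_glue x ω hω)
    · exact ENNReal.zero_ne_top

/-- The limit in the definition genuinely exists: numerator and denominator converge after
rescaling, and the limiting denominator is at least w(x, x) = 1. -/
theorem specification_eq (hd : 0 < d) (hf : f ∈ X.SV) (A : Set X.Point) (x : X.Point) :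
    X.specification f Λ A x =
      (X.fibreSum Λ (A.indicator (X.gibbsDensity f Λ)) x).toReal := by
  rw [fibreSum_indicator_gibbsDensity hd hf, ENNReal.toReal_div]
  refine Tendsto.limUnder_eq ?_
  have hA := tendsto_boltzmannSum (Λ := Λ) hd hf A x
  have hU := tendsto_boltzmannSum (Λ := Λ) hd hf Set.univ x
  rw [Set.indicator_univ] at hU
  refine (hA.div hU (ENNReal.toReal_ne_zero.2
    ⟨fibreSum_weight_ne_zero x, fibreSum_weight_ne_top hd hf x⟩)).congr fun n => ?_
  exact div_div_div_cancel_right₀ (Real.exp_ne_zero _) _ _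

variable [DiscreteTopology 𝓐] [MeasurableSpace 𝓐] [DiscreteMeasurableSpace 𝓐]

theorem measurable_gibbsDensity (hf : f ∈ X.SV) : Measurable (X.gibbsDensity f Λ) :=
  (measurable_fibreSum (measurable_weight (measurable_of_SV hf))).inv

end Density

/-! ### Balance equations -/

section Balance

variable [Fintype 𝓐] [DiscreteTopology 𝓐] [MeasurableSpace 𝓐] [DiscreteMeasurableSpace 𝓐]
  {X : Subshift d 𝓐} {f : X.Point → ℝ} {Λ : Finset (Site d)} {μ : Measure X.Point}

/-- The balance equation for the finite set `Λ`: under `μ`, the masses of `x` and of `y` that agrees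
with `x` off `Λ` have ratio `weight x y`. -/
def IsBalanced (X : Subshift d 𝓐) (f : X.Point → ℝ) (Λ : Finset (Site d)) (μ : Measure X.Point) :
    Prop :=
  ∀ g : X.Point → X.Point → ℝ≥0∞, Measurable (fun p : X.Point × X.Point => g p.1 p.2) →
    ∫⁻ x, X.fibreSum Λ (g x) x ∂μ = ∫⁻ x, X.fibreSum Λ (fun y => g y x * X.weight f x y) x ∂μ

/-- Invariance of `μ` under resampling inside `Λ` according to the Gibbs density. -/
def IsResamplingInvariant (X : Subshift d 𝓐) (f : X.Point → ℝ) (Λ : Finset (Site d))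
    (μ : Measure X.Point) : Prop :=
  ∀ F : X.Point → ℝ≥0∞, Measurable F →
    ∫⁻ x, F x ∂μ = ∫⁻ x, X.fibreSum Λ (fun y => F y * X.gibbsDensity f Λ y) x ∂μ

theorem isBalanced_iff_isResamplingInvariant (hd : 0 < d) (hf : f ∈ X.SV) :
    X.IsBalanced f Λ μ ↔ X.IsResamplingInvariant f Λ μ := by
  have hρ : Measurable (X.gibbsDensity f Λ) := measurable_gibbsDensity hf
  have hw := measurable_weight (measurable_of_SV hf)
  constructor
  · intro h F hF
    -- With this test function the left side collapses to ∫ F since ρ_Λ sums to 1 on each fibre, and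
    -- on the right ρ_Λ(x) w(x, y) becomes ρ_Λ(y).
    have hK := h (fun x y => F x * X.gibbsDensity f Λ y)
      ((hF.comp measurable_fst).mul (hρ.comp measurable_snd))
    simp only [fibreSum_const_mul, fibreSum_gibbsDensity hd hf, mul_one] at hK
    rw [hK]
    refine lintegral_congr fun x => fibreSum_congr fun y hy => ?_
    rw [mul_assoc, gibbsDensity_mul_weight hd hf hy]
  · intro h g hg
    have hg' : Measurable fun p : X.Point × X.Point => g p.2 p.1 * X.weight f p.1 p.2 :=
      (hg.comp measurable_swap).mul hw
    -- Resampling both sides turns each integrand into a double sum over one fibre; exchanging the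
    -- sums and applying detailed balance matches them pointwise.
    rw [h _ (measurable_fibreSum hg), 
      h _ (measurable_fibreSum (g := fun x y => g y x * X.weight f x y) hg')]
    refine lintegral_congr fun x => ?_
    simp only [mul_comm _ (X.gibbsDensity f Λ _), ← fibreSum_const_mul]
    rw [fibreSum_comm]
    refine fibreSum_congr fun y _ => fibreSum_congr fun z hz => ?_
    rw [mul_left_comm, gibbsDensity_mul_weight hd hf hz, mul_comm]

theorem isResamplingInvariant_of_measure_eq (hf : f ∈ X.SV)
    (h : ∀ A, MeasurableSet A →
      μ A = ∫⁻ x, X.fibreSum Λ (A.indicator (X.gibbsDensity f Λ)) x ∂μ) :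
    X.IsResamplingInvariant f Λ μ := by
  have hρ : Measurable (X.gibbsDensity f Λ) := measurable_gibbsDensity hf
  have hmul : ∀ F : X.Point → ℝ≥0∞, Measurable F →
      Measurable (X.fibreSum Λ fun y => F y * X.gibbsDensity f Λ y) :=
    fun F hF => measurable_fibreSum_const (hF.mul hρ)
  intro F hF
  refine Measurable.ennreal_induction (motive := fun F => ∫⁻ x, F x ∂μ =
    ∫⁻ x, X.fibreSum Λ (fun y => F y * X.gibbsDensity f Λ y) x ∂μ) ?_ ?_ ?_ hF
  · intro c s hs
    have : ∀ y, s.indicator (fun _ => c) y * X.gibbsDensity f Λ y =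
        c * s.indicator (X.gibbsDensity f Λ) y := fun y => by
      by_cases hy : y ∈ s <;> simp [hy]
    simp only [this, fibreSum_const_mul]
    rw [lintegral_const_mul _ (measurable_fibreSum_const (hρ.indicator hs)), ← h s hs,
      lintegral_indicator_const hs]
  · intro F G _ hF hG ihF ihG
    simp only [Pi.add_apply, add_mul, fibreSum_add]
    rw [lintegral_add_left hF, lintegral_add_left (hmul F hF), ihF, ihG]
  · intro F hF hmono ih
    have hmono' : Monotone fun n y => F n y * X.gibbsDensity f Λ y :=
      fun m n hmn y => mul_le_mul' (hmono hmn y) le_rfl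
    simp only [ENNReal.iSup_mul]
    simp only [fibreSum_iSup hmono']
    rw [lintegral_iSup hF hmono, lintegral_iSup (fun n => hmul (F n) (hF n))
      fun m n hmn x => fibreSum_mono (hmono' hmn) x]
    exact iSup_congr ih

/-- Integrating the DLR equation over the whole space gives invariance on sets. Conversely,
invariance applied to s ∩ A with s in 𝓑_{Λᶜ} gives the defining property of the conditional
expectation. -/
theorem condExp_eq_specification_iff [IsFiniteMeasure μ] (hd : 0 < d) (hf : f ∈ X.SV) :
    (∀ A : Set X.Point, MeasurableSet A →
      μ⟦A | X.coordSigma (Λ : Set (Site d))ᶜ⟧ =ᵐ[μ] X.specification f Λ A) ↔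
        X.IsResamplingInvariant f Λ μ := by
  have hρ : Measurable (X.gibbsDensity f Λ) := measurable_gibbsDensity hf
  have hm := X.coordSigma_le (Λ : Set (Site d))ᶜ
  have hspec : ∀ A, X.specification f Λ A =
      fun x => (X.fibreSum Λ (A.indicator (X.gibbsDensity f Λ)) x).toReal :=
    fun A => funext fun x => specification_eq hd hf A x
  have hle : ∀ (A : Set X.Point) x, X.fibreSum Λ (A.indicator (X.gibbsDensity f Λ)) x ≤ 1 := fun A x =>
    (fibreSum_mono (Set.indicator_le_self A _) x).trans (fibreSum_gibbsDensity hd hf x).le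
  have hint : ∀ A, MeasurableSet A → Integrable (X.specification f Λ A) μ := by
    intro A hA
    rw [hspec]
    refine integrable_toReal_of_lintegral_ne_top
      (measurable_fibreSum_const (hρ.indicator hA)).aemeasurable ?_
    exact ((lintegral_mono (hle A)).trans_lt (by simp [measure_lt_top])).ne
  have hset : ∀ A s, MeasurableSet A → ∫ x in s, X.specification f Λ A x ∂μ =
      (∫⁻ x in s, X.fibreSum Λ (A.indicator (X.gibbsDensity f Λ)) x ∂μ).toReal := by
    intro A s hA
    rw [hspec]
    refine integral_toReal (measurable_fibreSum_const (hρ.indicator hA)).aemeasurable ?_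
    exact Eventually.of_forall fun x => (hle A x).trans_lt ENNReal.one_lt_top
  constructor
  · intro h
    refine isResamplingInvariant_of_measure_eq hf fun A hA => ?_
    have h1 := hset A Set.univ hA
    rw [setIntegral_univ, setLIntegral_univ, ← integral_congr_ae (h A hA), integral_condExp hm,
      integral_indicator_const _ hA] at h1
    refine (ENNReal.toReal_eq_toReal_iff' (measure_ne_top μ A) ?_).1 ?_
    · exact ((lintegral_mono (hle A)).trans_lt (by simp [measure_lt_top])).ne
    · simpa [Measure.real] using h1
  · intro h A hA
    refine (ae_eq_condExp_of_forall_setIntegral_eq hm ((integrable_const 1).indicator hA)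
      (fun s _ _ => (hint A hA).integrableOn) (fun s hs _ => ?_) ?_).symm
    · rw [hset A s hA, ← lintegral_indicator (hm s hs), setIntegral_indicator hA, setIntegral_const]
      -- Properness: the indicator of s is constant on fibres, so it moves inside the sum.
      have key : ∀ x, s.indicator (X.fibreSum Λ (A.indicator (X.gibbsDensity f Λ))) x =
          X.fibreSum Λ (fun y => (s ∩ A).indicator 1 y * X.gibbsDensity f Λ y) x := by
        intro x
        by_cases hx : x ∈ s
        · rw [Set.indicator_of_mem hx]
          refine fibreSum_congr fun y hy => ?_
          have hy := (hy.mem_iff_of_measurableSet hs).1 hx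
          by_cases hyA : y ∈ A <;> simp [hy, hyA]
        · rw [Set.indicator_of_notMem hx]
          have : X.fibreSum Λ (fun y => (s ∩ A).indicator 1 y * X.gibbsDensity f Λ y) x =
              X.fibreSum Λ (fun y => 0 * X.gibbsDensity f Λ y) x :=
            fibreSum_congr fun y hy => by
              have hy : y ∉ s := fun h => hx ((hy.mem_iff_of_measurableSet hs).2 h)
              simp [hy]
          rw [this, fibreSum_const_mul, zero_mul]
      have hsA : MeasurableSet (s ∩ A) := (hm s hs).inter hA
      simp only [key]
      rw [← h _ (measurable_one.indicator hsA), lintegral_indicator_one hsA]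
      simp [Measure.real]
    · rw [hspec]
      exact (measurable_fibreSum_coordSigma (hρ.indicator hA)).ennreal_toReal.aestronglyMeasurable

end Balance

/-! ### The counting measures of the Gibbs relation -/

section Counting

variable (X : Subshift d 𝓐)

/-- The pairs of points that agree off `Λ`. -/
def agreeSet (Λ : Finset (Site d)) : Set (RelGraph X.gibbsRel) :=
  {p | X.AgreeOff Λ p.left p.right}

theorem flip_preimage_agreeSet (Λ : Finset (Site d)) :
    RelGraph.flip ⁻¹' X.agreeSet Λ = X.agreeSet Λ :=
  Set.ext fun _ => ⟨fun h => h.symm, fun h => h.symm⟩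

theorem agreeSet_box_mono : Monotone fun n => X.agreeSet (box d (n + 1)) :=
  fun _ _ hmn _ hp i hi => hp i fun h => hi (box_mono d (Nat.succ_le_succ hmn) h)

theorem iUnion_agreeSet_box : ⋃ n, X.agreeSet (box d (n + 1)) = Set.univ := by
  refine Set.eq_univ_of_forall fun p => Set.mem_iUnion.2 ?_
  obtain ⟨Λ, hΛ⟩ := p.2
  obtain ⟨m, hm⟩ := exists_subset_box Λ
  exact ⟨m, fun i hi => hΛ i fun h => hi (box_mono d m.le_succ (hm h))⟩

variable {X} in
-- The pairs (x, y) with y agreeing with x off `Λ` are parametrized injectively by the admissible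
-- fillings of `Λ`. This links the counting measures to `fibreSum`.
theorem tsum_fibre_indicator_agreeSet [Fintype 𝓐] (Λ : Finset (Site d)) (g : X.Point → X.Point → ℝ≥0∞)
    (x : X.Point) :
    ∑' p : RelGraph X.gibbsRel, (RelGraph.left ⁻¹' {x}).indicator
      ((X.agreeSet Λ).indicator fun p => g p.left p.right) p = X.fibreSum Λ (g x) x := by
  classical
  let j : {ω : Λ → 𝓐 // glue ω x.1 ∈ X.carrier} → RelGraph X.gibbsRel := fun ω =>
    ⟨(x, ⟨glue ω.1 x.1, ω.2⟩), (agreeOff_glue x ω.1 ω.2).rel⟩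
  have hj : Function.Injective j := by
    intro ω η h
    have h1 : glue ω.1 x.1 = glue η.1 x.1 := congrArg (fun p => p.right.1) h
    refine Subtype.ext (funext fun i => ?_)
    have := congrFun h1 i
    simpa [glue] using this
  rw [← hj.tsum_eq]
  · rw [fibreSum, ← tsum_fintype (L := .unconditional _), ← Subtype.val_injective.tsum_eq
      (g := fun ω : {ω : Λ → 𝓐 // glue ω x.1 ∈ X.carrier} => ω.1)]
    · refine tsum_congr fun ω => ?_
      rw [dif_pos ω.2, Set.indicator_of_mem (show j ω ∈ RelGraph.left ⁻¹' {x} from rfl),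
        Set.indicator_of_mem (show j ω ∈ X.agreeSet Λ from agreeOff_glue x ω.1 ω.2)]
      rfl
    · intro ω hω
      by_cases h : glue ω x.1 ∈ X.carrier
      · exact ⟨⟨ω, h⟩, rfl⟩
      · simp [h] at hω
  · intro p hp
    have hx : p ∈ RelGraph.left ⁻¹' {x} := Set.mem_of_indicator_ne_zero hp
    rw [Function.mem_support, Set.indicator_of_mem hx] at hp
    have hx : p.left = x := hx
    have hag : X.AgreeOff Λ p.left p.right := Set.mem_of_indicator_ne_zero hp
    rw [hx] at hag
    exact ⟨⟨fun i => p.right.1 i, hag.glue_restrict.symm ▸ p.right.2⟩,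
      Subtype.ext (Prod.ext hx.symm (Subtype.ext hag.glue_restrict))⟩

variable [MeasurableSpace 𝓐]

theorem measurable_left : Measurable (RelGraph.left : RelGraph X.gibbsRel → X.Point) :=
  measurable_fst.comp measurable_subtype_coe

theorem measurable_right : Measurable (RelGraph.right : RelGraph X.gibbsRel → X.Point) :=
  measurable_snd.comp measurable_subtype_coe

theorem measurable_flip :
    Measurable (RelGraph.flip : RelGraph X.gibbsRel → RelGraph X.gibbsRel) :=
  ((measurable_right X).prodMk (measurable_left X)).subtype_mk

theorem measurable_comp_left_right {g : X.Point → X.Point → ℝ≥0∞}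
    (hg : Measurable fun p : X.Point × X.Point => g p.1 p.2) :
    Measurable fun p : RelGraph X.gibbsRel => g p.left p.right :=
  hg.comp measurable_subtype_coe

theorem measurable_comp_swap {g : X.Point → X.Point → ℝ≥0∞}
    (hg : Measurable fun p : X.Point × X.Point => g p.1 p.2) :
    Measurable fun p : X.Point × X.Point => g p.2 p.1 :=
  hg.comp measurable_swap

variable [Fintype 𝓐] [DiscreteMeasurableSpace 𝓐]

theorem measurableSet_agreeSet (Λ : Finset (Site d)) : MeasurableSet (X.agreeSet Λ) := by
  have : X.agreeSet Λ = ⋂ i : {i // i ∉ Λ}, {p : RelGraph X.gibbsRel |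
      p.left.1 i = p.right.1 i} := by
    ext p
    simp [agreeSet, AgreeOff]
  rw [this]
  refine MeasurableSet.iInter fun i => measurableSet_eq_fun ?_ ?_
  · exact (measurable_pi_apply i.1).comp (measurable_subtype_coe.comp (measurable_left X))
  · exact (measurable_pi_apply i.1).comp (measurable_subtype_coe.comp (measurable_right X))

variable [DiscreteTopology 𝓐] (μ : Measure X.Point)

variable {X}

theorem setLIntegral_leftCounting (Λ : Finset (Site d)) {g : X.Point → X.Point → ℝ≥0∞}
    (hg : Measurable fun p : X.Point × X.Point => g p.1 p.2) :
    ∫⁻ p in X.agreeSet Λ, g p.left p.right ∂leftCounting X.gibbsRel μ =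
      ∫⁻ x, X.fibreSum Λ (g x) x ∂μ := by
  have hm : Measurable ((X.agreeSet Λ).indicator fun p => g p.left p.right) :=
    (measurable_comp_left_right X hg).indicator (X.measurableSet_agreeSet Λ)
  rw [← lintegral_indicator (X.measurableSet_agreeSet Λ), leftCounting,
    Measure.lintegral_bind X.measurable_fibre_count.aemeasurable hm.aemeasurable]
  refine lintegral_congr fun x => ?_
  rw [← lintegral_indicator (measurable_left X (measurableSet_singleton x)),
    lintegral_count, tsum_fibre_indicator_agreeSet]

theorem setLIntegral_rightCounting (Λ : Finset (Site d)) {g : X.Point → X.Point → ℝ≥0∞}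
    (hg : Measurable fun p : X.Point × X.Point => g p.1 p.2) :
    ∫⁻ p in X.agreeSet Λ, g p.left p.right ∂rightCounting X.gibbsRel μ =
      ∫⁻ x, X.fibreSum Λ (fun y => g y x) x ∂μ := by
  rw [rightCounting, setLIntegral_map (X.measurableSet_agreeSet Λ)
    (measurable_comp_left_right X hg) (measurable_flip X), flip_preimage_agreeSet]
  exact setLIntegral_leftCounting μ Λ (g := fun x y => g y x) (measurable_comp_swap X hg)

/-- Each fibre has at most |𝓐|^|Λ| points. The resulting σ-finiteness is what the Radon–Nikodym
arguments rest on. -/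
theorem leftCounting_agreeSet_lt_top [IsFiniteMeasure μ] (Λ : Finset (Site d)) :
    leftCounting X.gibbsRel μ (X.agreeSet Λ) < ⊤ := by
  have h := setLIntegral_leftCounting μ Λ (g := fun _ _ => 1) measurable_const
  rw [setLIntegral_one] at h
  rw [h]
  refine (lintegral_mono (g := fun _ => (Fintype.card (Λ → 𝓐) : ℝ≥0∞)) fun x => ?_).trans_lt ?_
  · classical
    refine (Finset.sum_le_sum (g := fun _ => 1) fun ω _ => ?_).trans ?_
    · split_ifs <;> simp
    · simp
  · rw [lintegral_const]
    exact ENNReal.mul_lt_top (ENNReal.natCast_lt_top _) (measure_lt_top μ _)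

instance sigmaFinite_leftCounting [IsFiniteMeasure μ] :
    SigmaFinite (leftCounting X.gibbsRel μ) :=
  ⟨⟨{ set := fun n => X.agreeSet (box d (n + 1))
      set_mem := fun _ => trivial
      finite := fun _ => leftCounting_agreeSet_lt_top μ _
      spanning := X.iUnion_agreeSet_box }⟩⟩

instance sigmaFinite_rightCounting [IsFiniteMeasure μ] :
    SigmaFinite (rightCounting X.gibbsRel μ) :=
  ⟨⟨{ set := fun n => X.agreeSet (box d (n + 1))
      set_mem := fun _ => trivial
      finite := fun n => by
        rw [rightCounting, Measure.map_apply (measurable_flip X) (X.measurableSet_agreeSet _),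
          flip_preimage_agreeSet]
        exact leftCounting_agreeSet_lt_top μ _
      spanning := X.iUnion_agreeSet_box }⟩⟩

variable {μ}

theorem leftCounting_eq_zero_iff {C : Set (RelGraph X.gibbsRel)} (hC : MeasurableSet C) :
    leftCounting X.gibbsRel μ C = 0 ↔ ∀ᵐ x ∂μ, ∀ p ∈ C, p.left ≠ x := by
  have hm : Measurable fun x : X.Point =>
      (Measure.count.restrict (RelGraph.left ⁻¹' {x}) : Measure (RelGraph X.gibbsRel)) C :=
    (Measure.measurable_coe hC).comp X.measurable_fibre_count
  rw [leftCounting, Measure.bind_apply hC X.measurable_fibre_count.aemeasurable,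
    lintegral_eq_zero_iff hm]
  refine eventually_congr (Eventually.of_forall fun x => ?_)
  dsimp only
  rw [Pi.zero_apply, Measure.restrict_apply hC, Measure.count_eq_zero_iff,
    Set.eq_empty_iff_forall_notMem]
  exact forall_congr' fun p => not_and

theorem leftCounting_absolutelyContinuous (h : IsQuasiInvariant X.gibbsRel μ) :
    leftCounting X.gibbsRel μ ≪ rightCounting X.gibbsRel μ := by
  refine Measure.AbsolutelyContinuous.mk fun C hC h0 => ?_
  rw [rightCounting, Measure.map_apply (measurable_flip X) hC,
    leftCounting_eq_zero_iff (measurable_flip X hC)] at h0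
  -- The second coordinates of `C` form a null set that need not be measurable, while
  -- quasi-invariance speaks of measurable sets. The saturation of `N` contains the first
  -- coordinates of `C`.
  obtain ⟨N, hN, hNm, hN0⟩ := exists_measurable_superset_of_null h0
  refine (leftCounting_eq_zero_iff hC).2 ?_
  filter_upwards [measure_eq_zero_iff_ae_notMem.1 (h N hNm hN0)] with x hx p hp hpx
  refine hx ⟨p.right, hN fun hall => hall p.flip hp rfl, ?_⟩
  exact hpx ▸ X.gibbsRel.symm p.2

/-- Test on the pairs whose second point lies in a null set A: they are ν_s-null, hence ν_r-null, so
almost no x is related to a point of A. -/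
theorem isQuasiInvariant_of_absolutelyContinuous
    (h : leftCounting X.gibbsRel μ ≪ rightCounting X.gibbsRel μ) :
    IsQuasiInvariant X.gibbsRel μ := by
  intro A hA hA0
  have hC : MeasurableSet (RelGraph.right ⁻¹' A : Set (RelGraph X.gibbsRel)) :=
    measurable_right X hA
  have hl : leftCounting X.gibbsRel μ (RelGraph.right ⁻¹' A) = 0 := by
    refine h ?_
    rw [rightCounting, Measure.map_apply (measurable_flip X) hC,
      leftCounting_eq_zero_iff (measurable_flip X hC)]
    filter_upwards [measure_eq_zero_iff_ae_notMem.1 hA0] with x hx p hp hpx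
    exact hx (hpx ▸ hp)
  refine measure_eq_zero_iff_ae_notMem.2 ?_
  filter_upwards [(leftCounting_eq_zero_iff hC).1 hl] with x hx ⟨y, hy, hyx⟩
  exact hx ⟨(x, y), X.gibbsRel.symm hyx⟩ hy rfl

end Counting

/-! ### Gibbs measures and balance equations -/

section Gibbs

variable [Fintype 𝓐] [DiscreteTopology 𝓐] [MeasurableSpace 𝓐] [DiscreteMeasurableSpace 𝓐]
  {X : Subshift d 𝓐} {f : X.Point → ℝ} {μ : Measure X.Point}

theorem measurable_weight_relGraph (hf : f ∈ X.SV) :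
    Measurable fun p : RelGraph X.gibbsRel => X.weight f p.right p.left :=
  measurable_comp_left_right X (g := fun x y => X.weight f y x)
    (measurable_comp_swap X (measurable_weight (measurable_of_SV hf)))

/-- Quasi-invariance gives ν_r ≪ ν_s, so the derivative recovers ν_r; conversely a density yields
ν_r ≪ ν_s, hence quasi-invariance, and the derivative is unique. -/
theorem isGibbsMeasure_iff_withDensity (hd : 0 < d) (hf : f ∈ X.SV) [IsProbabilityMeasure μ] :
    X.IsGibbsMeasure f μ ↔ leftCounting X.gibbsRel μ =
      (rightCounting X.gibbsRel μ).withDensity fun p => X.weight f p.right p.left := by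
  simp only [IsGibbsMeasure, IsConformal, ofReal_exp_neg_cocycle hd hf]
  constructor
  · rintro ⟨-, hq, hD⟩
    rw [← withDensity_congr_ae hD]
    exact (Measure.withDensity_rnDeriv_eq _ _ (leftCounting_absolutelyContinuous hq)).symm
  · intro h
    refine ⟨inferInstance, isQuasiInvariant_of_absolutelyContinuous ?_, ?_⟩
    · rw [h]
      exact withDensity_absolutelyContinuous _ _
    · rw [h]
      exact Measure.rnDeriv_withDensity _ (measurable_weight_relGraph hf)

theorem setLIntegral_withDensity_weight (hf : f ∈ X.SV) (Λ : Finset (Site d))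
    {g : X.Point → X.Point → ℝ≥0∞} (hg : Measurable fun p : X.Point × X.Point => g p.1 p.2) :
    ∫⁻ p in X.agreeSet Λ, g p.left p.right
      ∂(rightCounting X.gibbsRel μ).withDensity (fun p => X.weight f p.right p.left) =
      ∫⁻ x, X.fibreSum Λ (fun y => g y x * X.weight f x y) x ∂μ := by
  rw [setLIntegral_withDensity_eq_setLIntegral_mul _ (measurable_weight_relGraph hf)
    (measurable_comp_left_right X hg) (X.measurableSet_agreeSet Λ)]
  rw [← setLIntegral_rightCounting μ Λ (g := fun x y => g x y * X.weight f y x)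
    (hg.mul (measurable_comp_swap X (measurable_weight (measurable_of_SV hf))))]
  exact lintegral_congr fun p => mul_comm _ _

theorem withDensity_weight_iff_isBalanced (hf : f ∈ X.SV) :
    leftCounting X.gibbsRel μ =
      (rightCounting X.gibbsRel μ).withDensity (fun p => X.weight f p.right p.left) ↔
      ∀ Λ : Finset (Site d), Λ.Nonempty → X.IsBalanced f Λ μ := by
  constructor
  · intro h Λ _ g hg
    rw [← setLIntegral_leftCounting μ Λ hg, ← setLIntegral_withDensity_weight hf Λ hg, ← h]
  · intro h
    refine Measure.ext fun C hC => ?_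
    have hC' := hC
    obtain ⟨C', hC', rfl⟩ := hC'
    have key : ∀ n, leftCounting X.gibbsRel μ (Subtype.val ⁻¹' C' ∩ X.agreeSet (box d (n + 1))) =
        (rightCounting X.gibbsRel μ).withDensity (fun p => X.weight f p.right p.left)
          (Subtype.val ⁻¹' C' ∩ X.agreeSet (box d (n + 1))) := by
      intro n
      -- Balance is given only for nonempty sets; the shift to n + 1 puts the origin in every box.
      have hne : (box d (n + 1)).Nonempty := ⟨0, (mem_box_iff_natAbs _).2 fun l => by simp⟩
      have hg : Measurable fun p : X.Point × X.Point => C'.indicator (1 : X.Point × X.Point → ℝ≥0∞) (p.1, p.2) :=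
        measurable_one.indicator hC'
      have hL := h _ hne (fun x y => C'.indicator 1 (x, y)) hg
      rw [← setLIntegral_leftCounting μ _ hg, ← setLIntegral_withDensity_weight hf _ hg] at hL
      have hind : ∀ ν : Measure (RelGraph X.gibbsRel), ∫⁻ p in X.agreeSet (box d (n + 1)),
          C'.indicator (1 : X.Point × X.Point → ℝ≥0∞) (p.left, p.right) ∂ν =
          ν (Subtype.val ⁻¹' C' ∩ X.agreeSet (box d (n + 1))) := by
        intro ν
        rw [← Measure.restrict_apply hC, ← lintegral_indicator_one hC]
        rfl
      rwa [hind, hind] at hL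
    have hU : Subtype.val ⁻¹' C' =
        ⋃ n, (Subtype.val ⁻¹' C' ∩ X.agreeSet (box d (n + 1))) := by
      rw [← Set.inter_iUnion, iUnion_agreeSet_box, Set.inter_univ]
    have hmono : Monotone fun n => Subtype.val ⁻¹' C' ∩ X.agreeSet (box d (n + 1)) :=
      fun m n hmn => Set.inter_subset_inter_right _ (X.agreeSet_box_mono hmn)
    -- Continuity from below along the boxes extends the equality to all of `C`.
    rw [hU, hmono.measure_iUnion, hmono.measure_iUnion]
    exact iSup_congr key

end Gibbs

end Subshift

end

theorem mainTheorem4 {d : ℕ} (hd : 0 < d) {𝓐 : Type*} [Fintype 𝓐]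
    [TopologicalSpace 𝓐] [DiscreteTopology 𝓐] [MeasurableSpace 𝓐] [DiscreteMeasurableSpace 𝓐]
    (X : Subshift d 𝓐) (hX : X.IsOfFiniteType) (f : X.Point → ℝ) (hf : f ∈ X.SV)
    (μ : Measure X.Point) :
    X.IsGibbsMeasure f μ ↔ IsProbabilityMeasure μ ∧ X.SatisfiesDLR f μ := by
  have key : ∀ [IsProbabilityMeasure μ], X.IsGibbsMeasure f μ ↔ X.SatisfiesDLR f μ := by
    intro _
    rw [Subshift.isGibbsMeasure_iff_withDensity hd hf,
      Subshift.withDensity_weight_iff_isBalanced hf]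
    -- Balance and the DLR equations are matched separately for each `Λ`.
    refine forall_congr' fun Λ => imp_congr_right fun _ => ?_
    rw [Subshift.isBalanced_iff_isResamplingInvariant hd hf,
      Subshift.condExp_eq_specification_iff hd hf]
  constructor
  · intro h
    have := h.1
    exact ⟨this, key.1 h⟩
  · rintro ⟨_, h⟩
    exact key.2 h
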